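/- Let $G=(V,E)$ be a finite acyclic directed network with unit-capacity edges (parallel edges allowed), a source node $s$ of out-degree $\delta$, and $t$ distinct receiver nodes, such that the min-cut between $s$ and each receiver equals $n$. Let $k\ge 0$ and $\mu\ge 1$ be integers with $k+\mu\le n$, and let $\mathbb{F}_q$ be a finite field with $$q>\binom{n^3t^2+\delta}{\mu-1}+t .$$ Then a secure multicast network code at rate $k$ against a wiretapper who observes at most $\mu$ edges exists over $\mathbb{F}_q$. That is, there are a $k\times n$ matrix $H$ over $\mathbb{F}_q$ of rank $k$ and a linear network code over $\mathbb{F}_q$ for $G$ carrying $n$ symbols $Y=(y_1,\dots,y_n)$ injected at $s$ (each edge leaving $s$ carries a linear combination of the $y_i$, and each edge leaving another node carries a linear combination of the packets entering that node) such that, when a random message $S\in\mathbb{F}_q^k$ of any law is encoded into $Y$ chosen uniformly at random from the coset $\{y\in\mathbb{F}_q^n: Hy=S\}$: (i) every receiver can compute $Y$, hence $S=HY$, from its incoming packets; (ii) for every set $W\subseteq E$ with $|W|\le\mu$, the packets $Z_W$ on the edges of $W$ satisfy $H(S\mid Z_W)=H(S)$ (Shannon entropy). The bound on $q$ does not depend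 on the number of nodes or edges of the network. -/

import Mathlib

namespace WiretapNetwork

/-- A network: a finite directed multigraph (parallel edges allowed).  Every edge has unit capacity,
that is, it carries one symbol of the alphabet. -/
structure Network (V E : Type*) where
  /-- the node that the edge leaves -/
  tail : E → V
  /-- the node that the edge enters -/
  head : E → V

namespace Network

variable {V E : Type*} (G : Network V E)

/-- There is an edge from `u` to `v`. -/
def Adj (u v : V) : Prop := ∃ e, G.tail e = u ∧ G.head e = v

/-- No directed cycles. -/
def Acyclic : Prop := ∀ v, ¬ Relation.TransGen G.Adj v v

/-- The edges entering a node. -/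
def inEdges [Fintype E] [DecidableEq V] (v : V) : Finset E :=
  Finset.univ.filter fun e => G.head e = v

/-- The number of edges leaving a node. -/
def outDegree [Fintype E] [DecidableEq V] (v : V) : ℕ :=
  (Finset.univ.filter fun e => G.tail e = v).card

/-- The capacity of the cut `(X, V \ X)`: the number of edges leaving `X`. -/
def cutValue [Fintype E] [DecidableEq V] (X : Finset V) : ℕ :=
  (Finset.univ.filter fun e => G.tail e ∈ X ∧ G.head e ∉ X).card

/-- The minimum capacity of a cut separating `s` from `r` is equal to `n`. -/
def MinCutEq [Fintype E] [DecidableEq V] (s r : V) (n : ℕ) : Prop :=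
  IsLeast {c | ∃ X : Finset V, s ∈ X ∧ r ∉ X ∧ c = G.cutValue X} n

end Network

/-- A linear network code over `F` that carries `n` symbols `y` injected at the source: every edge
`e` has a global coding vector `vec e`, and its packet is `vec e ⬝ᵥ y`.  The source forms arbitrary
linear combinations of the `n` symbols; at any other node the packet on an outgoing edge is a linear
combination of the packets on the incoming edges. -/
structure LinearNetworkCode {V E : Type*} [Fintype E] [DecidableEq V]
    (G : Network V E) (source : V) (F : Type*) [Field F] (n : ℕ) where
  /-- local coding coefficients: `localCoeff d e` multiplies the packet of `d` in that of `e` -/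
  localCoeff : E → E → F
  /-- global coding vectors -/
  vec : E → Fin n → F
  vec_eq : ∀ e, G.tail e ≠ source →
    vec e = ∑ d ∈ G.inEdges (G.tail e), localCoeff d e • vec d

namespace LinearNetworkCode

variable {V E : Type*} [Fintype E] [DecidableEq V] {G : Network V E} {source : V}
  {F : Type*} [Field F] {n : ℕ}

/-- The packets seen on a set `W` of edges when `y` is injected at the source. -/
def packets (c : LinearNetworkCode G source F n) (W : Finset E) (y : Fin n → F) : W → F :=
  fun e => c.vec e ⬝ᵥ y

/-- The node `r` can compute all `n` injected symbols from its incoming packets. -/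
def Decodable (c : LinearNetworkCode G source F n) (r : V) : Prop :=
  ∃ D : (G.inEdges r → F) → (Fin n → F), ∀ y, D (c.packets (G.inEdges r) y) = y

end LinearNetworkCode

/-- A coset code (wiretap code at the source) for `k` message symbols and `n` channel symbols, given
by a `k × n` parity check matrix `H` of full row rank.  The message is the syndrome. -/
structure CosetCode (F : Type*) [Field F] (k n : ℕ) where
  /-- the parity check matrix -/
  H : Matrix (Fin k) (Fin n) F
  rank_eq : H.rank = k

namespace CosetCode

variable {F : Type*} [Field F] [Fintype F] [DecidableEq F] {k n : ℕ}

/-- The coset of the channel words with syndrome `m`. -/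
def coset (C : CosetCode F k n) (m : Fin k → F) : Finset (Fin n → F) :=
  Finset.univ.filter fun y => C.H.mulVec y = m

theorem coset_nonempty (C : CosetCode F k n) (m : Fin k → F) : (C.coset m).Nonempty := by
  have h : LinearMap.range C.H.mulVecLin = ⊤ := by
    apply Submodule.eq_top_of_finrank_eq
    have := C.rank_eq
    rw [Matrix.rank] at this
    simpa using this
  obtain ⟨y, hy⟩ := LinearMap.range_eq_top.1 h m
  exact ⟨y, by simpa [coset] using hy⟩

/-- The probabilistic encoder: a uniformly random word of the coset that the message specifies. -/
noncomputable def encode (C : CosetCode F k n) (m : Fin k → F) : PMF (Fin n → F) :=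
  PMF.uniformOfFinset (C.coset m) (C.coset_nonempty m)

end CosetCode

/-- Shannon entropy (in nats) of a random variable with finitely many values and law `p`. -/
noncomputable def entropy {α : Type*} [Fintype α] (p : PMF α) : ℝ :=
  -∑ a, (p a).toReal * Real.log (p a).toReal

/-- Conditional Shannon entropy `H(A | B)` (in nats), where `P` is the joint law of `(A, B)`. -/
noncomputable def condEntropy {α β : Type*} [Fintype α] [Fintype β] (P : PMF (α × β)) : ℝ :=
  -∑ x : α × β, (P x).toReal * Real.log ((P x).toReal / ((P.map Prod.snd) x.2).toReal)

section Secure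

variable {V E : Type*} [Fintype E] [DecidableEq E] [DecidableEq V] {G : Network V E} {source : V}
  {F : Type*} [Field F] [Fintype F] [DecidableEq F] {k n : ℕ}

/-- The joint law of the message and of the packets on the edges of `W`, when the message has the
law `p`, is encoded by the coset code and then sent with the linear network code. -/
noncomputable def wiretapLaw (C : CosetCode F k n) (c : LinearNetworkCode G source F n)
    (p : PMF (Fin k → F)) (W : Finset E) : PMF ((Fin k → F) × (W → F)) :=
  p.bind fun m => (C.encode m).map fun y => (m, c.packets W y)

/-- The coset code with the network code is a secure multicast of `k` symbols to the nodes of `T`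
against a wiretapper observing at most `μ` edges: every receiver decodes all channel symbols `y`
(hence the message, which is `C.H.mulVec y`), and for each law of the message the observation of
any at most `μ` edges leaves the uncertainty about the message unchanged. -/
def IsSecureMulticast (C : CosetCode F k n) (c : LinearNetworkCode G source F n)
    (T : Finset V) (μ : ℕ) : Prop :=
  (∀ r ∈ T, c.Decodable r) ∧
    ∀ (p : PMF (Fin k → F)) (W : Finset E), W.card ≤ μ →
      condEntropy (wiretapLaw C c p W) = entropy p

end Secure

end WiretapNetwork

namespace WiretapNetwork

/-! ### Avoiding subspaces over a finite field -/

section LinearAlgebra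

/-! Any fixed `H` of full rank will do; only the network code is adapted to it. Secrecy holds as
soon as the row space of `H` meets the span of any `μ` coding vectors only in 0: by duality every
syndrome then has a word invisible on the observed edges, and translating by it shows that the
packets are independent of the message.

A field size free of the network size comes from pruning. Take a smallest set of arcs between
consecutive edges that still carries `n` disjoint paths to each receiver. Each arc is then critical:
some receiver has no flow without it. For a pair of receivers, at most `n ^ 3` edges are entered by
two different arcs, one critical for each (`card_critical_le`), so at most `n ^ 3 * t ^ 2` edges
have several incoming arcs. Every other edge not leaving the source forwards a packet or carries
zero. Hence all nonzero coding vectors are those of at most `M = n ^ 3 * t ^ 2 + δ` leaders.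

The vectors are chosen greedily in topological order. At a leader it suffices to avoid one proper
subspace per receiver, keeping the fronts of its paths independent, and one per set of at most `μ -
1` leaders in a dominating family, for secrecy (`PartialCode.exists_insert_of_leader`). This is at
most `M.choose (μ - 1) + t` subspaces, too few to cover the available space. -/

theorem exists_mem_forall_notMem_of_card_le {K V ι : Type*} [Field K] [Fintype K] [AddCommGroup V]
    [Module K V] (s : Finset ι) (B : ι → Submodule K V) (I : Submodule K V)
    (h : ∀ i ∈ s, ¬ I ≤ B i) (hs : s.card ≤ Fintype.card K) : ∃ x ∈ I, ∀ i ∈ s, x ∉ B i := by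
  classical
  induction s using Finset.induction_on with
  | empty => exact ⟨0, I.zero_mem, by simp⟩
  | insert a s ha ih =>
    rw [Finset.card_insert_of_notMem ha] at hs
    obtain ⟨x, hxI, hx⟩ := ih (fun i hi => h i (Finset.mem_insert_of_mem hi)) (by omega)
    by_cases hxa : x ∈ B a
    · obtain ⟨y, hyI, hya⟩ := SetLike.not_le_iff_exists.1 (h a (Finset.mem_insert_self a s))
      by_contra! hcon
      -- All points `y + c • x` avoid `B a`. There are more of them than members of `s`, so two
      -- would share some `B i`, which would then contain `x`.
      have key : ∀ c : K, ∃ i ∈ s, y + c • x ∈ B i := by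
        intro c
        obtain ⟨i, hi, hmem⟩ := hcon (y + c • x) (I.add_mem hyI (I.smul_mem c hxI))
        rcases Finset.mem_insert.1 hi with rfl | hi
        · exact absurd ((Submodule.add_mem_iff_left _ (Submodule.smul_mem _ c hxa)).1 hmem) hya
        · exact ⟨i, hi, hmem⟩
      choose f hf hfm using key
      obtain ⟨c, -, d, -, hcd, hfcd⟩ := Finset.exists_ne_map_eq_of_card_lt_of_maps_to
        (s := Finset.univ) (t := s) (f := f) (by rw [Finset.card_univ]; omega) (fun c _ => hf c)
      have h1 := (B (f c)).sub_mem (hfm c) (hfcd ▸ hfm d)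
      rw [add_sub_add_left_eq_sub, ← sub_smul] at h1
      exact hx _ (hf c) (((B (f c)).smul_mem_iff (sub_ne_zero.2 hcd)).1 h1)
    · refine ⟨x, hxI, fun i hi => ?_⟩
      rcases Finset.mem_insert.1 hi with rfl | hi
      exacts [hxa, hx i hi]

theorem disjoint_sup_span_singleton {K V : Type*} [Field K] [AddCommGroup V] [Module K V]
    {U Z : Submodule K V} {x : V} (h : Disjoint U Z) (hx : x ∉ U ⊔ Z) :
    Disjoint U (Z ⊔ Submodule.span K {x}) :=
  h.disjoint_sup_right_of_disjoint_sup_left (Submodule.disjoint_span_singleton_of_notMem hx)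

/-- A family of subsets of `Λ` of size at most `m` that dominates all of them. -/
theorem exists_dominating_family {α : Type*} [DecidableEq α] (Λ : Finset α) {m M : ℕ}
    (hΛ : Λ.card ≤ M) (hm : m ≤ M) :
    ∃ 𝓕 : Finset (Finset α), 𝓕.card ≤ M.choose m ∧ (∀ W ∈ 𝓕, W ⊆ Λ ∧ W.card ≤ m) ∧
      ∀ W ⊆ Λ, W.card ≤ m → ∃ W' ∈ 𝓕, W ⊆ W' := by
  -- If `Λ` has fewer than `m` elements, `Λ` itself is the only member, and `m ≤ M` makes the bound
  -- at least 1.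
  refine ⟨Λ.powersetCard (min m Λ.card), ?_, fun W hW => ?_, fun W hW hWm => ?_⟩
  · rw [Finset.card_powersetCard]
    rcases le_total m Λ.card with h | h
    · rw [min_eq_left h]; exact Nat.choose_le_choose m hΛ
    · rw [min_eq_right h, Nat.choose_self]; exact Nat.choose_pos hm
  · rw [Finset.mem_powersetCard] at hW
    exact ⟨hW.1, hW.2.trans_le (min_le_left _ _)⟩
  · obtain ⟨W', h1, h2, h3⟩ := Finset.exists_subsuperset_card_eq hW
      (le_min hWm (Finset.card_le_card hW)) (min_le_right m Λ.card)
    exact ⟨W', Finset.mem_powersetCard.2 ⟨h2, h3⟩, h1⟩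

end LinearAlgebra

/-! ### Perfect matchings and Hall's theorem -/

section Matching

theorem exists_perm_forall {Ω : Type*} [Fintype Ω] [DecidableEq Ω] (R : Ω → Ω → Prop)
    [∀ x y, Decidable (R x y)]
    (h : ∀ s : Finset Ω, s.card ≤ (Finset.univ.filter fun y => ∃ x ∈ s, R x y).card) :
    ∃ π : Equiv.Perm Ω, ∀ x, R x (π x) := by
  obtain ⟨f, hf, hfR⟩ := (Finset.all_card_le_biUnion_card_iff_exists_injective
    (fun x => Finset.univ.filter (R x))).1 fun s => by
      convert h s using 2
      ext y; simp
  exact ⟨Equiv.ofBijective f (Finite.injective_iff_bijective.1 hf),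
    fun x => (Finset.mem_filter.1 (hfR x)).2⟩

/-- An edge `(v, P v)` of a perfect matching `P` on an alternating closed walk is avoided by some
other perfect matching. -/
theorem exists_perm_ne_of_reachable {Ω : Type*} [Finite Ω] (R : Ω → Ω → Prop)
    (P : Equiv.Perm Ω) (hP : ∀ x, R x (P x)) {v y : Ω} (hvy : R v y) (hne : y ≠ P v)
    (hreach : Relation.ReflTransGen (fun x z => R x (P z)) (P.symm y) v) :
    ∃ π : Equiv.Perm Ω, (∀ x, R x (π x)) ∧ π v ≠ P v := by
  classical
  have := Fintype.ofFinite Ω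
  obtain ⟨π, hπ⟩ := exists_perm_forall (fun x z => R x z ∧ (x = v → z ≠ P v)) fun s => by
    by_cases hv : v ∈ s
    · have hsub : (s.erase v).map P.toEmbedding ⊆
          Finset.univ.filter fun y => ∃ x ∈ s, R x y ∧ (x = v → y ≠ P v) := by
        intro z hz
        obtain ⟨x, hx, rfl⟩ := Finset.mem_map.1 hz
        rw [Finset.mem_erase] at hx
        simp only [Finset.mem_filter, Finset.mem_univ, true_and]
        exact ⟨x, hx.2, hP x, fun h => absurd h hx.1⟩
      have hcard : ((s.erase v).map P.toEmbedding).card + 1 = s.card := by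
        rw [Finset.card_map, Finset.card_erase_add_one hv]
      rw [← hcard, Nat.succ_le_iff]
      -- If Hall's condition failed without the edge `(v, P v)`, then `s.erase v` would be closed
      -- under alternating steps and contain their start, hence contain `v`.
      refine Finset.card_lt_card (hsub.ssubset_of_ne fun heq => ?_)
      have hin : ∀ z, (∃ x ∈ s, R x z ∧ (x = v → z ≠ P v)) → P.symm z ∈ s.erase v := by
        intro z hz
        have : z ∈ (s.erase v).map P.toEmbedding := by
          rw [heq]; simpa using hz
        obtain ⟨x, hx, rfl⟩ := Finset.mem_map.1 this
        simpa using hx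
      have hall : ∀ w, Relation.ReflTransGen (fun x z => R x (P z)) (P.symm y) w →
          w ∈ s.erase v := by
        intro w hw
        induction hw with
        | refl => exact hin y ⟨v, hv, hvy, fun _ => hne⟩
        | @tail b c _ hbc ih =>
          rw [Finset.mem_erase] at ih
          simpa using hin (P c) ⟨b, ih.2, hbc, fun h => absurd h ih.1⟩
      exact Finset.notMem_erase v s (hall v hreach)
    · rw [← Finset.card_map P.toEmbedding]
      refine Finset.card_le_card fun z hz => ?_
      obtain ⟨x, hx, rfl⟩ := Finset.mem_map.1 hz
      simp only [Finset.mem_filter, Finset.mem_univ, true_and]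
      exact ⟨x, hx, hP x, fun h => absurd (h ▸ hx) hv⟩
  exact ⟨π, fun x => (hπ x).1, (hπ v).2 rfl⟩

end Matching

/-! ### Orbits leaving through tokens -/

section Orbits

variable {E : Type*} {n : ℕ}

/-- One step along a permutation of `E ⊕ Fin n` that stays in `E`. -/
def OrbitStep (f : Equiv.Perm (E ⊕ Fin n)) (x y : E) : Prop := f (.inl x) = .inl y

/-- The orbit of `x` leaves `E` at the token `j`. -/
def ExitsAt (f : Equiv.Perm (E ⊕ Fin n)) (x : E) (j : Fin n) : Prop :=
  ∃ w, Relation.ReflTransGen (OrbitStep f) x w ∧ f (.inl w) = .inr j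

theorem exists_exitsAt [Finite E] (f : Equiv.Perm (E ⊕ Fin n)) (x : E)
    (hx : ¬ Relation.TransGen (OrbitStep f) x x) : ∃ j, ExitsAt f x j := by
  by_contra! hno
  have key : ∀ i : ℕ, ∃ e, (f ^ (i + 1)) (.inl x) = .inl e ∧
      Relation.TransGen (OrbitStep f) x e := by
    have succ : ∀ e, Relation.ReflTransGen (OrbitStep f) x e → ∃ e', f (.inl e) = .inl e' := by
      intro e he
      rcases h : f (.inl e) with e' | j
      · exact ⟨e', rfl⟩
      · exact absurd ⟨e, he, h⟩ (hno j)
    intro i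
    induction i with
    | zero =>
      obtain ⟨e, he⟩ := succ x .refl
      exact ⟨e, by simpa using he, .single he⟩
    | succ i ih =>
      obtain ⟨e, he, hxe⟩ := ih
      obtain ⟨e', he'⟩ := succ e hxe.to_reflTransGen
      exact ⟨e', by rw [pow_succ', Equiv.Perm.mul_apply, he, he'], hxe.tail he'⟩
  -- An orbit that never left `E` would be back at `x` after `orderOf f` steps.
  obtain ⟨e, he, hxe⟩ := key (orderOf f - 1)
  rw [Nat.sub_add_cancel (orderOf_pos f), pow_orderOf_eq_one] at he
  exact hx (by rwa [← Sum.inl_injective he] at hxe)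

/-- Predecessors under a permutation are unique, so two orbits with the same exit are nested. -/
theorem transGen_or_of_exitsAt (f : Equiv.Perm (E ⊕ Fin n)) {x y : E} {j : Fin n}
    (hx : ExitsAt f x j) (hy : ExitsAt f y j) (hxy : x ≠ y) :
    Relation.TransGen (OrbitStep f) x y ∨ Relation.TransGen (OrbitStep f) y x := by
  obtain ⟨w, hxw, hw⟩ := hx
  obtain ⟨w', hyw, hw'⟩ := hy
  obtain rfl : w = w' := Sum.inl_injective (f.injective (hw.trans hw'.symm))
  have hU : Relator.RightUnique (Function.swap (OrbitStep f)) := by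
    intro a b c hb hc
    exact Sum.inl_injective (f.injective (Eq.trans hb (Eq.symm hc)))
  rcases Relation.ReflTransGen.total_of_right_unique hU (Relation.reflTransGen_swap.2 hxw)
    (Relation.reflTransGen_swap.2 hyw) with h | h
  · rcases Relation.reflTransGen_iff_eq_or_transGen.1 (Relation.reflTransGen_swap.1 h) with h | h
    exacts [absurd h hxy, .inr h]
  · rcases Relation.reflTransGen_iff_eq_or_transGen.1 (Relation.reflTransGen_swap.1 h) with h | h
    exacts [absurd h.symm hxy, .inl h]

end Orbits

/-! ### Flows as matchings, and the number of encoding edges -/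

section Flows

variable {E : Type*} {n : ℕ}

/-- The bipartite graph whose perfect matchings are the systems of `n` disjoint paths from `S` to
`T` along the arcs of `A`: the left copy of a vertex is matched with the right copy of its
predecessor, with the token of a path that starts there, or with itself if no path visits it; the
left tokens are matched with the last vertices of the paths. -/
def Admissible (A : Set (E × E)) (S T : Set E) : E ⊕ Fin n → E ⊕ Fin n → Prop
  | .inl v, .inl u => u = v ∨ (u, v) ∈ A
  | .inl v, .inr _ => v ∈ S
  | .inr _, .inl u => u ∈ T
  | .inr _, .inr _ => False

/-- All flows to `T` agree with `P` at `v`. -/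
def IsCritical (A : Set (E × E)) (S T : Set E) (P : Equiv.Perm (E ⊕ Fin n)) (v : E) : Prop :=
  ∀ π : Equiv.Perm (E ⊕ Fin n), (∀ x, Admissible A S T x (π x)) → π (.inl v) = P (.inl v)

/-- The target constrains only the left tokens, so arcs used by a flow to one receiver may serve a
flow to another. -/
theorem Admissible.of_inl {A : Set (E × E)} {S T T' : Set E} {v : E} {y : E ⊕ Fin n}
    (h : Admissible A S T (.inl v) y) : Admissible A S T' (.inl v) y := by
  cases y <;> exact h

variable {A : Set (E × E)} {S T T' : Set E} {P Q : Equiv.Perm (E ⊕ Fin n)}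

/-- A step of `P⁻¹ * Q` goes back along an arc of `Q` and forward along one of `P`. Such steps from
`v` to `w`, followed by the `P`-path from `w` down to `v`, would close an alternating walk, and
switching along it would give a flow to `T` that enters `v` differently. -/
theorem IsCritical.not_reflTransGen [Finite E] (hP : ∀ x, Admissible A S T x (P x))
    (hQ : ∀ x, Admissible A S T' x (Q x)) {v w : E} (hv : IsCritical A S T P v)
    (hPQ : Q (.inl v) ≠ P (.inl v))
    (hψ : Relation.TransGen (OrbitStep (P⁻¹ * Q)) v w) :
    ¬ Relation.ReflTransGen (OrbitStep P) v w := by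
  intro hvw
  obtain ⟨v₁, hv₁, hv₁w⟩ := Relation.TransGen.head'_iff.1 hψ
  have hstep : ∀ a b, OrbitStep (P⁻¹ * Q) a b → P (.inl b) = Q (.inl a) := by
    intro a b hab
    rw [← show (P⁻¹ * Q) (.inl a) = .inl b from hab]
    simp
  obtain ⟨π, hπ, hne⟩ := exists_perm_ne_of_reachable (Admissible A S T) P hP (v := .inl v)
    (y := Q (.inl v)) (hQ _).of_inl hPQ (by
      rw [← hstep v v₁ hv₁, Equiv.symm_apply_apply]
      refine Relation.ReflTransGen.trans
        (Relation.ReflTransGen.lift Sum.inl (fun a b hab => ?_) _ _ hv₁w)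
        (Relation.ReflTransGen.lift Sum.inl (fun a b hab => ?_) _ _
          (Relation.reflTransGen_swap.2 hvw))
      · change Admissible A S T (.inl a) (P (.inl b))
        rw [hstep a b hab]; exact (hQ _).of_inl
      · change Admissible A S T (.inl a) (P (.inl b))
        rw [show P (.inl b) = .inl a from hab]; exact Or.inl rfl)
  exact hne (hv π hπ)

/-- A flow sends a visited vertex to its predecessor, so its orbits run upstream. -/
theorem lt_of_transGen_orbitStep {ρ : E → ℕ} (hρ : ∀ u v, (u, v) ∈ A → ρ u < ρ v)
    (hP : ∀ x, Admissible A S T x (P x)) {v w : E} (hv : P (.inl v) ≠ .inl v)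
    (h : Relation.TransGen (OrbitStep P) v w) : ρ w < ρ v := by
  have step : ∀ a b, P (.inl a) ≠ .inl a → OrbitStep P a b →
      ρ b < ρ a ∧ P (.inl b) ≠ .inl b := by
    intro a b ha hab
    have hab' : P (.inl a) = .inl b := hab
    refine ⟨?_, fun hb => ha ?_⟩
    · have := hP (.inl a)
      rw [hab'] at this ha
      rcases this with rfl | h
      exacts [absurd rfl ha, hρ _ _ h]
    · rw [hab', P.injective (hab'.trans hb.symm)]
  suffices ρ w < ρ v ∧ P (.inl w) ≠ .inl w from this.1
  induction h with
  | single h => exact step _ _ hv h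
  | tail _ h ih => exact ⟨(step _ _ ih.2 h).1.trans ih.1, (step _ _ ih.2 h).2⟩

/-- Two flows have few vertices that both of them enter through different critical arcs. -/
theorem card_critical_le [Finite E] {ρ : E → ℕ} (hρ : ∀ u v, (u, v) ∈ A → ρ u < ρ v)
    (hP : ∀ x, Admissible A S T x (P x)) (hQ : ∀ x, Admissible A S T' x (Q x)) (Z : Finset E)
    (hne : ∀ v ∈ Z, Q (.inl v) ≠ P (.inl v))
    (hZP : ∀ v ∈ Z, P (.inl v) ≠ .inl v ∧ IsCritical A S T P v)
    (hZQ : ∀ v ∈ Z, Q (.inl v) ≠ .inl v ∧ IsCritical A S T' Q v) : Z.card ≤ n ^ 3 := by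
  have hp : ∀ v : Z, ∃ j, ExitsAt P v j := fun v => exists_exitsAt P v fun h =>
    (lt_of_transGen_orbitStep hρ hP (hZP v v.2).1 h).false
  have hq : ∀ v : Z, ∃ j, ExitsAt Q v j := fun v => exists_exitsAt Q v fun h =>
    (lt_of_transGen_orbitStep hρ hQ (hZQ v v.2).1 h).false
  have hr : ∀ v : Z, ∃ j, ExitsAt (P⁻¹ * Q) v j := fun v => exists_exitsAt (P⁻¹ * Q) v fun h =>
    (hZP v v.2).2.not_reflTransGen hP hQ (hne v v.2) h .refl
  choose p hp using hp
  choose q hq using hq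
  choose r hr using hr
  -- Criticality at `v` puts `v` upstream of `w` on their common `P`-path, and criticality at `w`
  -- puts `w` upstream of `v` on their common `Q`-path; the rank forbids having both.
  have key : ∀ v w : Z, p v = p w → q v = q w →
      Relation.TransGen (OrbitStep (P⁻¹ * Q)) (v : E) w → (v : E) = w := by
    intro v w hpvw hqvw hvw
    by_contra hne'
    have h1 := (hZP v v.2).2.not_reflTransGen hP hQ (hne v v.2) hvw
    have h2 := (hZQ w w.2).2.not_reflTransGen (w := v) hQ hP (hne w w.2).symm (by
      rw [← Relation.transGen_swap]
      refine Relation.TransGen.mono (fun a b hab => ?_) _ _ hvw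
      have hab' : (P⁻¹ * Q) (.inl a) = .inl b := hab
      change (Q⁻¹ * P) (.inl b) = .inl a
      rw [← hab']; simp)
    have hpP := (transGen_or_of_exitsAt P (hp v) (hpvw ▸ hp w) hne').resolve_left
      fun h => h1 h.to_reflTransGen
    have hqQ := (transGen_or_of_exitsAt Q (hq v) (hqvw ▸ hq w) hne').resolve_right
      fun h => h2 h.to_reflTransGen
    exact absurd (lt_of_transGen_orbitStep hρ hP (hZP w w.2).1 hpP)
      (lt_of_transGen_orbitStep hρ hQ (hZQ v v.2).1 hqQ).le.not_gt
  have hinj : Function.Injective fun v : Z => (p v, q v, r v) := by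
    intro v w h
    simp only [Prod.mk.injEq] at h
    obtain ⟨h1, h2, h3⟩ := h
    by_contra hvw
    have hvw' : (v : E) ≠ w := fun h => hvw (Subtype.ext h)
    rcases transGen_or_of_exitsAt _ (hr v) (h3 ▸ hr w) hvw' with h | h
    exacts [hvw' (key v w h1 h2 h), hvw' (key w v h1.symm h2.symm h).symm]
  have := Fintype.card_le_of_injective _ hinj
  simp only [Fintype.card_coe, Fintype.card_prod, Fintype.card_fin] at this
  calc Z.card ≤ n * (n * n) := this
    _ = n ^ 3 := by ring

/-- A smallest set of arcs that carries flows to all the sets `T r` has few vertices with more than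
one incoming arc. -/
theorem exists_arcs_card_encoding_le [Fintype E] [DecidableEq E] {ι : Type*} [DecidableEq ι]
    (A₀ : Finset (E × E)) {ρ : E → ℕ} (hρ : ∀ u v, (u, v) ∈ A₀ → ρ u < ρ v) (S : Set E)
    (R : Finset ι) (T : ι → Set E)
    (hflow : ∀ r ∈ R, ∃ π : Equiv.Perm (E ⊕ Fin n), ∀ x, Admissible A₀ S (T r) x (π x)) :
    ∃ (A : Finset (E × E)) (P : ι → Equiv.Perm (E ⊕ Fin n)), A ⊆ A₀ ∧
      (∀ r ∈ R, ∀ x, Admissible A S (T r) x (P r x)) ∧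
      (Finset.univ.filter fun v => ∃ u w, u ≠ w ∧ (u, v) ∈ A ∧ (w, v) ∈ A).card
        ≤ n ^ 3 * R.card ^ 2 := by
  classical
  let good : Finset (E × E) → Prop := fun A =>
    ∀ r ∈ R, ∃ π : Equiv.Perm (E ⊕ Fin n), ∀ x, Admissible A S (T r) x (π x)
  obtain ⟨A, hA, hmin⟩ := Finset.exists_min_image (A₀.powerset.filter good) Finset.card
    ⟨A₀, Finset.mem_filter.2 ⟨Finset.mem_powerset_self _, hflow⟩⟩
  simp only [Finset.mem_filter, Finset.mem_powerset] at hA hmin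
  obtain ⟨hsub, hgood⟩ := hA
  have hP : ∃ P : ι → Equiv.Perm (E ⊕ Fin n), ∀ r ∈ R, ∀ x, Admissible A S (T r) x (P r x) := by
    choose! P hP using hgood
    exact ⟨P, hP⟩
  obtain ⟨P, hP⟩ := hP
  refine ⟨A, P, hsub, hP, ?_⟩
  -- By minimality, deleting an arc destroys all flows to some receiver.
  have hcrit : ∀ u v, (u, v) ∈ A → ∃ r ∈ R, ∀ π : Equiv.Perm (E ⊕ Fin n),
      (∀ x, Admissible A S (T r) x (π x)) → π (.inl v) = .inl u := by
    intro u v huv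
    by_contra! hcon
    refine absurd (hmin (A.erase (u, v)) ⟨(Finset.erase_subset _ _).trans hsub, fun r hr => ?_⟩)
      (Finset.card_erase_lt_of_mem huv).not_ge
    obtain ⟨π, hπ, hne⟩ := hcon r hr
    refine ⟨π, fun x => ?_⟩
    have hx := hπ x
    rcases x with x | j <;> rcases hy : π _ with y | i <;> rw [hy] at hx
    · rcases hx with rfl | hx
      · exact .inl rfl
      · refine .inr (Finset.mem_coe.2 (Finset.mem_erase.2 ⟨fun h => hne ?_, hx⟩))
        cases h; exact hy
    all_goals exact hx
  let Z : ι × ι → Finset E := fun p => Finset.univ.filter fun v =>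
    (P p.2 (.inl v) ≠ P p.1 (.inl v)) ∧
    (P p.1 (.inl v) ≠ .inl v ∧ IsCritical A S (T p.1) (P p.1) v) ∧
    (P p.2 (.inl v) ≠ .inl v ∧ IsCritical A S (T p.2) (P p.2) v)
  have hZ : ∀ p ∈ R ×ˢ R, (Z p).card ≤ n ^ 3 := by
    intro p hp
    rw [Finset.mem_product] at hp
    refine card_critical_le (A := A) (S := S) (fun u v h => hρ u v (hsub h)) (hP _ hp.1)
      (hP _ hp.2) (Z p) ?_ ?_ ?_ <;> intro v hv <;> have hv := (Finset.mem_filter.1 hv).2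
    exacts [hv.1, hv.2.1, hv.2.2]
  calc _ ≤ ((R ×ˢ R).biUnion Z).card := by
        refine Finset.card_le_card fun v hv => ?_
        obtain ⟨u, w, huw, hu, hw⟩ := (Finset.mem_filter.1 hv).2
        obtain ⟨r, hr, hcr⟩ := hcrit u v hu
        obtain ⟨r', hr', hcr'⟩ := hcrit w v hw
        have e1 := hcr _ (hP r hr)
        have e2 := hcr' _ (hP r' hr')
        have hne : ∀ a, (a, v) ∈ A → a ≠ v := by
          rintro a h rfl
          exact (hρ _ _ (hsub h)).false
        refine Finset.mem_biUnion.2 ⟨(r, r'), Finset.mem_product.2 ⟨hr, hr'⟩,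
          Finset.mem_filter.2 ⟨Finset.mem_univ _, ?_, ⟨?_, ?_⟩, ?_, ?_⟩⟩
        · simpa [e1, e2] using huw.symm
        · simpa [e1] using hne u hu
        · intro π hπ; rw [e1]; exact hcr π hπ
        · simpa [e2] using hne w hw
        · intro π hπ; rw [e2]; exact hcr' π hπ
    _ ≤ (R ×ˢ R).card * n ^ 3 := Finset.card_biUnion_le_card_mul _ _ _ hZ
    _ = n ^ 3 * R.card ^ 2 := by rw [Finset.card_product]; ring

end Flows

/-! ### Topological order and Menger's theorem -/

namespace Network

variable {V E : Type*}

theorem Acyclic.exists_rank [Finite V] {G : Network V E} (hG : G.Acyclic) :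
    ∃ ρ : E → ℕ, ∀ u v, G.head u = G.tail v → ρ u < ρ v := by
  classical
  have := Fintype.ofFinite V
  refine ⟨fun e => (Finset.univ.filter fun w => Relation.TransGen G.Adj w (G.tail e)).card,
    fun u v huv => Finset.card_lt_card ?_⟩
  have hadj : G.Adj (G.tail u) (G.tail v) := ⟨u, rfl, huv⟩
  refine (Finset.ssubset_iff_of_subset fun w hw => ?_).2 ⟨G.tail u, ?_, ?_⟩
  · simp only [Finset.mem_filter, Finset.mem_univ, true_and] at hw ⊢
    exact hw.tail hadj
  · simpa using Relation.TransGen.single hadj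
  · simpa using hG (G.tail u)

/-- Menger's theorem: a min-cut of value `n` gives `n` edge-disjoint paths. -/
theorem MinCutEq.exists_flow [Fintype V] [DecidableEq V] [Fintype E] [DecidableEq E] {G : Network V E} {s r : V} {n : ℕ}
    (h : G.MinCutEq s r n) :
    ∃ π : Equiv.Perm (E ⊕ Fin n), ∀ x, Admissible {p : E × E | G.head p.1 = G.tail p.2}
      {e | G.tail e = s} {e | G.head e = r} x (π x) := by
  classical
  refine exists_perm_forall _ fun L => ?_
  have hsr : s ≠ r := by
    obtain ⟨X, hs, hr, -⟩ := h.1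
    rintro rfl
    exact hr hs
  set N := Finset.univ.filter fun y => ∃ x ∈ L, Admissible {p : E × E | G.head p.1 = G.tail p.2}
      {e | G.tail e = s} {e | G.head e = r} x y with hN
  have hLN : L.toLeft ⊆ N.toLeft := fun e he => by
    rw [Finset.mem_toLeft] at he
    simp only [hN, Finset.mem_toLeft, Finset.mem_filter, Finset.mem_univ, true_and]
    exact ⟨_, he, .inl rfl⟩
  rw [← L.card_toLeft_add_card_toRight, ← N.card_toLeft_add_card_toRight]
  have hLr : L.toRight.card ≤ n := (Finset.card_le_univ _).trans (by simp)
  by_cases hS : ∃ e ∈ L.toLeft, G.tail e = s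
  · obtain ⟨e, he, hes⟩ := hS
    rw [Finset.mem_toLeft] at he
    have : N.toRight = Finset.univ := Finset.eq_univ_of_forall fun j => by
      simp only [hN, Finset.mem_toRight, Finset.mem_filter, Finset.mem_univ, true_and]
      exact ⟨_, he, hes⟩
    rw [this, Finset.card_univ, Fintype.card_fin]
    exact Nat.add_le_add (Finset.card_le_card hLN) hLr
  push Not at hS
  rcases L.toRight.eq_empty_or_nonempty with hR | ⟨j, hj⟩
  · rw [hR, Finset.card_empty]
    exact (Finset.card_le_card hLN).trans (Nat.le_add_right _ _)
  rw [Finset.mem_toRight] at hj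
  -- Edges entering `B` from outside are neighbours of `L` but not in `L`, and the min-cut provides
  -- at least `n` of them, enough to match the tokens.
  set B : Finset V := insert r (L.toLeft.image G.tail)
  have hcut := h.2 ⟨Bᶜ, by
    simp only [B, Finset.mem_compl, Finset.mem_insert, Finset.mem_image, not_or, not_exists,
      not_and]
    exact ⟨hsr, hS⟩, by simp [B], rfl⟩
  have hdisj : Disjoint L.toLeft
      (Finset.univ.filter fun e => G.tail e ∈ Bᶜ ∧ G.head e ∉ Bᶜ) := by
    rw [Finset.disjoint_left]
    intro e he he'
    have := (Finset.mem_filter.1 he').2.1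
    rw [Finset.mem_compl] at this
    exact this (Finset.mem_insert_of_mem (Finset.mem_image_of_mem _ he))
  calc L.toLeft.card + L.toRight.card ≤ L.toLeft.card + G.cutValue Bᶜ := by omega
    _ = _ := (Finset.card_union_of_disjoint hdisj).symm
    _ ≤ N.toLeft.card := by
      refine Finset.card_le_card (Finset.union_subset hLN fun e he => ?_)
      have := (Finset.mem_filter.1 he).2.2
      rw [Finset.mem_compl, not_not] at this
      simp only [hN, Finset.mem_toLeft, Finset.mem_filter, Finset.mem_univ, true_and]
      rcases Finset.mem_insert.1 this with h | h
      · exact ⟨_, hj, h⟩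
      · obtain ⟨v, hv, hve⟩ := Finset.mem_image.1 h
        exact ⟨_, Finset.mem_toLeft.1 hv, .inr hve.symm⟩
    _ ≤ _ := Nat.le_add_right _ _

end Network

/-! ### Greedy choice of the coding vectors -/

section Greedy

theorem image_update_of_notMem {E X : Type*} [DecidableEq E] {vec : E → X} {W : Finset E} {v : E}
    (hv : v ∉ W) (x : X) :
    Function.update vec v x '' (W : Set E) = vec '' (W : Set E) :=
  Set.image_congr fun _ hw => Function.update_of_ne (ne_of_mem_of_not_mem (Finset.mem_coe.1 hw) hv) _ _

variable {E ι K : Type*} [Field K] {n μ : ℕ}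

/-- The coding vectors of edges, together with those of the source symbols. -/
def withTokens (vec : E → Fin n → K) : E ⊕ Fin n → Fin n → K :=
  Sum.elim vec fun j => Pi.single j 1

/-- The positions that the paths of a flow have reached when the edges of `D` are processed. -/
def frontier (P : Equiv.Perm (E ⊕ Fin n)) (D : Finset E) : Set (E ⊕ Fin n) :=
  {y | (∀ e, y = .inl e → e ∈ D) ∧ ∀ d ∈ D, P (.inl d) ≠ y}

/-- A secure network code on the edges of `D`.  The in-neighbours of `v` are `A v`, the edges
outside `Λ` only forward. -/
structure PartialCode (A : E → Finset E) (S Λ : Finset E) (R : Finset ι)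
    (P : ι → Equiv.Perm (E ⊕ Fin n)) (U : Submodule K (Fin n → K)) (μ : ℕ)
    (D : Finset E) (vec : E → Fin n → K) : Prop where
  mem_span : ∀ v ∈ D, v ∉ S → vec v ∈ Submodule.span K (vec '' (A v : Set E))
  eq_leader : ∀ v ∈ D, vec v = 0 ∨ ∃ l ∈ Λ, l ∈ D ∧ vec l = vec v
  linearIndepOn : ∀ r ∈ R, LinearIndepOn K (withTokens vec) (frontier (P r) D)
  secure : ∀ W ⊆ D, W.card ≤ μ → Disjoint U (Submodule.span K (vec '' (W : Set E)))

namespace PartialCode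

variable {A : E → Finset E} {S Λ : Finset E} {R : Finset ι}
  {P : ι → Equiv.Perm (E ⊕ Fin n)} {U : Submodule K (Fin n → K)} {D : Finset E}
  {vec : E → Fin n → K}

theorem empty (vec : E → Fin n → K) : PartialCode A S Λ R P U μ ∅ vec where
  mem_span := by simp
  eq_leader := by simp
  linearIndepOn r _ := by
    have hbasis : LinearIndependent K fun j : Fin n => (Pi.single j 1 : Fin n → K) :=
      Pi.linearIndependent_single_one (Fin n) K
    have : LinearIndepOn K (withTokens vec) (Set.range (Sum.inr : Fin n → E ⊕ Fin n)) := by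
      rw [linearIndepOn_range_iff Sum.inr_injective]
      exact hbasis
    refine this.mono fun y hy => ?_
    rcases y with e | j
    · simpa using hy.1 e rfl
    · exact ⟨j, rfl⟩
  secure W hW _ := by
    rw [Finset.subset_empty.1 hW]
    simp

theorem mem_frontier {v : E} (hv : v ∉ D) (hA : A v ⊆ D)
    (hP : ∀ r ∈ R, ∀ w, P r (.inl w) = .inl w ∨ (∃ u ∈ A w, P r (.inl w) = .inl u) ∨
      (w ∈ S ∧ ∃ j, P r (.inl w) = .inr j)) {r : ι} (hr : r ∈ R)
    (hne : P r (.inl v) ≠ .inl v) : P r (.inl v) ∈ frontier (P r) D := by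
  refine ⟨fun e he => ?_, fun d hd hdv => ?_⟩
  · rcases hP r hr v with h | ⟨u, hu, h⟩ | ⟨-, j, h⟩
    · exact absurd h hne
    · rw [he] at h; exact Sum.inl_injective h ▸ hA hu
    · rw [he] at h; cases h
  · exact hv (Sum.inl_injective ((P r).injective hdv) ▸ hd)

variable [DecidableEq E]

/-- What the coding vector `x` of the next edge `v` has to satisfy. -/
theorem insert {v : E} {x : Fin n → K} (h : PartialCode A S Λ R P U μ D vec)
    (hv : v ∉ D) (hA : ∀ w ∈ insert v D, A w ⊆ D)
    (hspan : v ∉ S → x ∈ Submodule.span K (vec '' (A v : Set E)))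
    (hleader : v ∈ Λ ∨ x = 0 ∨ ∃ u ∈ D, x = vec u)
    (hx : ∀ r ∈ R, P r (.inl v) ≠ .inl v →
      x ∉ Submodule.span K (withTokens vec '' (frontier (P r) D \ {P r (.inl v)})))
    (hsec : ∀ W ⊆ D, W.card + 1 ≤ μ →
      Disjoint U (Submodule.span K (vec '' (W : Set E)) ⊔ Submodule.span K {x})) :
    PartialCode A S Λ R P U μ (insert v D) (Function.update vec v x) where
  mem_span w hw hwS := by
    rw [image_update_of_notMem (fun h => hv (hA w hw h))]
    rcases eq_or_ne w v with rfl | hwv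
    · simpa using hspan hwS
    · rw [Function.update_of_ne hwv]
      exact h.mem_span w ((Finset.mem_insert.1 hw).resolve_left hwv) hwS
  eq_leader := by
    have old : ∀ w ∈ D, vec w = 0 ∨ ∃ l ∈ Λ, l ∈ Insert.insert v D ∧
        Function.update vec v x l = vec w := by
      intro w hw
      refine (h.eq_leader w hw).imp_right ?_
      rintro ⟨l, hl, hlD, hlw⟩
      exact ⟨l, hl, Finset.mem_insert_of_mem hlD, by
        rw [Function.update_of_ne (ne_of_mem_of_not_mem hlD hv), hlw]⟩
    intro w hw
    rcases eq_or_ne w v with rfl | hwv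
    · rcases hleader with hΛ | h0 | ⟨u, hu, hux⟩
      · exact .inr ⟨w, hΛ, hw, rfl⟩
      · simp [h0]
      · simpa [hux] using old u hu
    · rw [Function.update_of_ne hwv]
      exact old w ((Finset.mem_insert.1 hw).resolve_left hwv)
  linearIndepOn r hr := by
    have hagree : Set.EqOn (withTokens vec) (withTokens (Function.update vec v x))
        (frontier (P r) D) := by
      rintro (e | j) hy
      · exact (Function.update_of_ne (ne_of_mem_of_not_mem (hy.1 e rfl) hv) _ _).symm
      · rfl
    by_cases hfix : P r (.inl v) = .inl v
    · refine ((h.linearIndepOn r hr).congr hagree).mono fun y hy => ⟨fun e he => ?_, fun d hd =>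
        hy.2 d (Finset.mem_insert_of_mem hd)⟩
      refine (Finset.mem_insert.1 (hy.1 e he)).resolve_left fun hev => ?_
      exact hy.2 v (Finset.mem_insert_self v D) (by rw [hfix, he, hev])
    -- The path through `v` advances: `v` replaces `P r (.inl v)` in the frontier.
    · have hsub : frontier (P r) D \ {P r (.inl v)} ⊆ frontier (P r) D := Set.sdiff_subset
      refine ((((h.linearIndepOn r hr).mono hsub).congr (hagree.mono hsub)).insert
        (x := .inl v) ?_).mono ?_
      · rw [← Set.image_congr (hagree.mono hsub)]
        simpa [withTokens] using hx r hr hfix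
      · intro y hy
        by_cases hyv : y = .inl v
        · exact .inl hyv
        refine .inr ⟨⟨fun e he => ?_, fun d hd => hy.2 d (Finset.mem_insert_of_mem hd)⟩,
          fun h' => hy.2 v (Finset.mem_insert_self v D) h'.symm⟩
        exact (Finset.mem_insert.1 (hy.1 e he)).resolve_left fun hev => hyv (by rw [he, hev])
  secure W hW hWμ := by
    by_cases hvW : v ∈ W
    · have hW' : W.erase v ⊆ D := by
        rw [← Finset.erase_insert hv]; exact Finset.erase_subset_erase v hW
      have := hsec (W.erase v) hW' (by rwa [Finset.card_erase_add_one hvW])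
      rw [← Finset.insert_erase hvW, Finset.coe_insert, Set.image_insert_eq, Function.update_self,
        image_update_of_notMem (Finset.notMem_erase v W), Submodule.span_insert, sup_comm]
      exact this
    · rw [image_update_of_notMem hvW]
      exact h.secure W (fun w hw => (Finset.mem_insert.1 (hW hw)).resolve_left
        fun h => hvW (h ▸ hw)) hWμ

/-- A packet seen elsewhere repeats a leader's packet or vanishes, so only leaders are worth
tapping. -/
theorem exists_leaders (h : PartialCode A S Λ R P U μ D vec) (W : Finset E) (hW : W ⊆ D) :
    ∃ W' ⊆ Λ ∩ D, W'.card ≤ W.card ∧ Submodule.span K (vec '' (W : Set E)) ≤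
      Submodule.span K (vec '' (W' : Set E)) := by
  have : ∀ w ∈ W, ∃ l, (l ∈ Λ ∧ l ∈ D ∧ vec l = vec w) ∨ vec w = 0 := fun w hw =>
    (h.eq_leader w (hW hw)).elim (fun h0 => ⟨w, .inr h0⟩)
      fun ⟨l, hl⟩ => ⟨l, .inl hl⟩
  choose! f hf using this
  refine ⟨(W.image f).filter (· ∈ Λ ∩ D), fun l hl => (Finset.mem_filter.1 hl).2,
    (Finset.card_filter_le _ _).trans Finset.card_image_le, Submodule.span_le.2 ?_⟩
  rintro _ ⟨w, hw, rfl⟩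
  rcases hf w hw with ⟨h1, h2, h3⟩ | h0
  · rw [← h3]
    refine Submodule.subset_span ⟨f w, ?_, rfl⟩
    simp only [Finset.coe_filter, Set.mem_ofPred_eq, Finset.mem_inter]
    exact ⟨Finset.mem_image_of_mem f hw, h1, h2⟩
  · rw [h0]; exact Submodule.zero_mem _

theorem exists_insert_of_notMem_leader {v : E} (h : PartialCode A S Λ R P U μ D vec)
    (hv : v ∉ D) (hA : ∀ w ∈ Insert.insert v D, A w ⊆ D)
    (hP : ∀ r ∈ R, ∀ w, P r (.inl w) = .inl w ∨ (∃ u ∈ A w, P r (.inl w) = .inl u) ∨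
      (w ∈ S ∧ ∃ j, P r (.inl w) = .inr j))
    (hvS : v ∉ S) (hcard : (A v).card ≤ 1) :
    ∃ x, PartialCode A S Λ R P U μ (Insert.insert v D) (Function.update vec v x) := by
  have hAv := hA v (Finset.mem_insert_self v D)
  rcases (A v).eq_empty_or_nonempty with hempty | ⟨u, hu⟩
  · refine ⟨0, h.insert hv hA (fun _ => Submodule.zero_mem _) (.inr (.inl rfl))
      (fun r hr hne => ?_) fun W hW hWμ => ?_⟩
    · rcases hP r hr v with h | ⟨u, hu, -⟩ | ⟨hS, -⟩
      · exact absurd h hne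
      · simp [hempty] at hu
      · exact absurd hS hvS
    · simpa using h.secure W hW (by omega)
  · refine ⟨vec u, h.insert hv hA (fun _ => Submodule.subset_span ⟨u, hu, rfl⟩)
      (.inr (.inr ⟨u, hAv hu, rfl⟩)) (fun r hr hne => ?_) fun W hW hWμ => ?_⟩
    · have hmem := mem_frontier hv hAv hP hr hne
      have hy : P r (.inl v) = .inl u := by
        rcases hP r hr v with h | ⟨u', hu', h⟩ | ⟨hS, -⟩
        · exact absurd h hne
        · rw [h, Finset.card_le_one.1 hcard u hu u' hu']
        · exact absurd hS hvS
      rw [hy] at hmem ⊢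
      exact (h.linearIndepOn r hr).notMem_span hmem
    · rw [← Submodule.span_union, ← Set.image_singleton, ← Set.image_union, Set.union_singleton,
        ← Finset.coe_insert]
      exact h.secure _ (Finset.insert_subset (hAv hu) hW) ((Finset.card_insert_le _ _).trans hWμ)

theorem exists_insert_of_leader [Fintype K] {M : ℕ} {v : E}
    (h : PartialCode A S Λ R P U μ D vec)
    (hv : v ∉ D) (hA : ∀ w ∈ Insert.insert v D, A w ⊆ D)
    (hP : ∀ r ∈ R, ∀ w, P r (.inl w) = .inl w ∨ (∃ u ∈ A w, P r (.inl w) = .inl u) ∨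
      (w ∈ S ∧ ∃ j, P r (.inl w) = .inr j))
    (hvΛ : v ∈ Λ) (hμ : 1 ≤ μ) (hU : Module.finrank K U + μ ≤ n) (hM : Λ.card ≤ M)
    (hμM : μ - 1 ≤ M) (hq : M.choose (μ - 1) + R.card < Fintype.card K) :
    ∃ x, PartialCode A S Λ R P U μ (Insert.insert v D) (Function.update vec v x) := by
  classical
  have hAv := hA v (Finset.mem_insert_self v D)
  let I : Submodule K (Fin n → K) :=
    if v ∈ S then ⊤ else Submodule.span K (vec '' (A v : Set E))
  have hIS : v ∈ S → I = ⊤ := fun hS => if_pos hS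
  have hIA : v ∉ S → I = Submodule.span K (vec '' (A v : Set E)) := fun hS => if_neg hS
  obtain ⟨𝓕, h𝓕card, h𝓕, h𝓕dom⟩ := exists_dominating_family (Λ ∩ D)
    ((Finset.card_le_card Finset.inter_subset_left).trans hM) hμM
  let Y : Finset E → Submodule K (Fin n → K) := fun W => Submodule.span K (vec '' (W : Set E))
  let B : ι ⊕ Finset E → Submodule K (Fin n → K) := Sum.elim
    (fun r => Submodule.span K (withTokens vec '' (frontier (P r) D \ {P r (.inl v)})))
    (fun W => U ⊔ Y W)
  obtain ⟨x, hxI, hx⟩ := exists_mem_forall_notMem_of_card_le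
    ((R.filter fun r => P r (.inl v) ≠ .inl v).disjSum (𝓕.filter fun W => ¬ I ≤ U ⊔ Y W)) B I
    (by
      rintro (r | W) hi
      · rw [Finset.inl_mem_disjSum, Finset.mem_filter] at hi
        have hmem := mem_frontier hv hAv hP hi.1 hi.2
        have hnot := (h.linearIndepOn r hi.1).notMem_span hmem
        refine fun hle => hnot (hle ?_)
        by_cases hS : v ∈ S
        · rw [hIS hS]; trivial
        · rw [hIA hS]
          rcases hP r hi.1 v with h | ⟨u, hu, h⟩ | ⟨hS', -⟩
          · exact absurd h hi.2
          · rw [h]; exact Submodule.subset_span ⟨u, hu, rfl⟩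
          · exact absurd hS' hS
      · rw [Finset.inr_mem_disjSum, Finset.mem_filter] at hi
        exact hi.2)
    (by
      rw [Finset.card_disjSum]
      have h1 := Finset.card_filter_le R fun r => P r (.inl v) ≠ .inl v
      have h2 := Finset.card_filter_le 𝓕 fun W => ¬ I ≤ U ⊔ Y W
      omega)
  refine ⟨x, h.insert hv hA (fun hS => hIA hS ▸ hxI) (.inl hvΛ) (fun r hr hne => ?_)
    fun W hW hWμ => ?_⟩
  · exact hx (.inl r) (by simp [hr, hne])
  · obtain ⟨W₁, hW₁, hW₁card, hspan₁⟩ := h.exists_leaders W hW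
    obtain ⟨W₂, hW₂, hsub⟩ := h𝓕dom W₁ hW₁ (by omega)
    obtain ⟨hW₂D, hW₂card⟩ := h𝓕 W₂ hW₂
    replace hW₂D : W₂ ⊆ D := hW₂D.trans Finset.inter_subset_right
    have hle : Submodule.span K (vec '' (W : Set E)) ≤ Y W₂ :=
      hspan₁.trans (Submodule.span_mono (Set.image_mono (by exact_mod_cast hsub)))
    have hdisj : Disjoint U (Y W₂) := h.secure W₂ hW₂D (by omega)
    refine Disjoint.mono_right (sup_le_sup_right hle _) ?_
    -- If `I` lies in `U ⊔ Y W₂`, that subspace cannot be avoided, but then `x` is already in `Y W₂`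
    -- and reveals nothing new. At the source this case is excluded by dimension, as `k + (μ - 1) <
    -- n`.
    by_cases hI : I ≤ U ⊔ Y W₂
    · suffices hIY : I ≤ Y W₂ by
        rwa [sup_eq_left.2 ((Submodule.span_singleton_le_iff_mem _ _).2 (hIY hxI))]
      by_cases hS : v ∈ S
      · exfalso
        rw [hIS hS, top_le_iff] at hI
        have h1 := Submodule.finrank_add_le_finrank_add_finrank U (Y W₂)
        rw [hI, finrank_top, Module.finrank_fin_fun] at h1
        have h2 : Module.finrank K (Y W₂) ≤ W₂.card := by
          have := finrank_span_finset_le_card (R := K) (W₂.image vec)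
          rw [Finset.coe_image] at this
          exact this.trans Finset.card_image_le
        omega
      · rw [hIA hS, Submodule.span_le]
        rw [hIA hS] at hI
        rintro _ ⟨d, hd, rfl⟩
        obtain ⟨a, ha, b, hb, hab⟩ := Submodule.mem_sup.1
          (hI (Submodule.subset_span ⟨d, hd, rfl⟩))
        -- The component `a` in `U` is also seen on `W₂` together with `d`, at most `μ` edges, so it
        -- is 0.
        have hd' := h.secure (Insert.insert d W₂) (Finset.insert_subset (hAv hd) hW₂D)
          ((Finset.card_insert_le _ _).trans (by omega))
        have hmem : a ∈ Submodule.span K (vec '' ((Insert.insert d W₂ : Finset E) : Set E)) := by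
          rw [eq_sub_of_add_eq hab]
          refine Submodule.sub_mem _ (Submodule.subset_span ⟨d, by simp, rfl⟩)
            (Submodule.span_mono (Set.image_mono ?_) hb)
          exact_mod_cast Finset.subset_insert d W₂
        rw [Submodule.disjoint_def.1 hd' a ha hmem, zero_add] at hab
        exact hab ▸ hb
    · exact disjoint_sup_span_singleton hdisj (hx (.inr W₂) (by simp [hW₂, hI]))

end PartialCode

theorem exists_partialCode_univ [Fintype E] [DecidableEq E] [Fintype K] {M : ℕ} (A : E → Finset E) {ρ : E → ℕ}
    (hρ : ∀ v, ∀ u ∈ A v, ρ u < ρ v) (S Λ : Finset E) (R : Finset ι)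
    (P : ι → Equiv.Perm (E ⊕ Fin n))
    (hP : ∀ r ∈ R, ∀ w, P r (.inl w) = .inl w ∨ (∃ u ∈ A w, P r (.inl w) = .inl u) ∨
      (w ∈ S ∧ ∃ j, P r (.inl w) = .inr j))
    (hΛ : ∀ v, v ∉ Λ → v ∉ S ∧ (A v).card ≤ 1) (U : Submodule K (Fin n → K))
    (hμ : 1 ≤ μ) (hU : Module.finrank K U + μ ≤ n) (hM : Λ.card ≤ M)
    (hμM : μ - 1 ≤ M) (hq : M.choose (μ - 1) + R.card < Fintype.card K) :
    ∃ vec, PartialCode A S Λ R P U μ Finset.univ vec := by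
  suffices ∀ D : Finset E, (∀ w ∈ D, A w ⊆ D) → ∃ vec, PartialCode A S Λ R P U μ D vec from
    this _ fun w _ => Finset.subset_univ _
  intro D
  induction D using Finset.induction_on_max_value ρ with
  | empty => exact fun _ => ⟨0, .empty 0⟩
  | insert v D hv hmax ih =>
    intro hD
    have hA : ∀ w ∈ insert v D, A w ⊆ D := by
      intro w hw u hu
      refine (Finset.mem_insert.1 (hD w hw hu)).resolve_left ?_
      rintro rfl
      have h1 := hρ w u hu
      rcases Finset.mem_insert.1 hw with rfl | hw
      exacts [h1.false, (hmax w hw).not_gt h1]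
    obtain ⟨vec, h⟩ := ih fun w hw => hA w (Finset.mem_insert_of_mem hw)
    by_cases hvΛ : v ∈ Λ
    · obtain ⟨x, hx⟩ := h.exists_insert_of_leader hv hA hP hvΛ hμ hU hM hμM hq
      exact ⟨_, hx⟩
    · obtain ⟨x, hx⟩ := h.exists_insert_of_notMem_leader hv hA hP (hΛ v hvΛ).1 (hΛ v hvΛ).2
      exact ⟨_, hx⟩

end Greedy

/-! ### From disjoint subspaces to perfect secrecy -/

section Entropy

theorem condEntropy_eq_of_prod {α β : Type*} [Fintype α] [Fintype β] (p : PMF α) (ν : PMF β)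
    (P : PMF (α × β)) (hP : ∀ a b, P (a, b) = p a * ν b) : condEntropy P = entropy p := by
  classical
  have hsum : ∀ {γ : Type _} [Fintype γ] (p : PMF γ), ∑ a, (p a).toReal = 1 := by
    intro γ _ p
    rw [← ENNReal.toReal_sum fun a _ => p.apply_ne_top a, ← tsum_fintype (L := .unconditional _), p.tsum_coe,
      ENNReal.toReal_one]
  have hsnd : ∀ b, (P.map Prod.snd) b = ν b := by
    intro b
    rw [PMF.map_apply, tsum_fintype, Fintype.sum_prod_type]
    simp only [hP, Finset.sum_ite_eq, Finset.mem_univ, if_true]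
    rw [← Finset.sum_mul, ← tsum_fintype (L := .unconditional _), p.tsum_coe, one_mul]
  unfold condEntropy entropy
  rw [Fintype.sum_prod_type]
  congr 1
  refine Finset.sum_congr rfl fun a _ => ?_
  have : ∀ b, (P (a, b)).toReal * Real.log ((P (a, b)).toReal / ((P.map Prod.snd) b).toReal) =
      (ν b).toReal * ((p a).toReal * Real.log (p a).toReal) := by
    intro b
    rw [hsnd, hP, ENNReal.toReal_mul]
    rcases eq_or_ne (ν b).toReal 0 with h | h
    · simp [h]
    · rw [mul_div_cancel_right₀ _ h]; ring
  simp only [this]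
  rw [← Finset.sum_mul, hsum, one_mul]

variable {V E : Type*} [Fintype E] [DecidableEq V] {G : Network V E} {source : V}
  {F : Type*} [Field F] {k n : ℕ}

/-- If no nonzero combination of the rows of `H` is seen on `W`, every syndrome has a word that is
invisible on `W`. -/
theorem CosetCode.exists_mulVec_eq (C : CosetCode F k n) (w : E → Fin n → F) (W : Finset E)
    (h : Disjoint (Submodule.span F (Set.range C.H.row)) (Submodule.span F (w '' (W : Set E))))
    (m : Fin k → F) : ∃ y, C.H.mulVec y = m ∧ ∀ e ∈ W, w e ⬝ᵥ y = 0 := by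
  let Z : (Fin n → F) →ₗ[F] (W → F) := Matrix.mulVecLin (Matrix.of fun e : W => w e)
  have hZ : ∀ y, y ∈ LinearMap.ker Z ↔ ∀ e ∈ W, w e ⬝ᵥ y = 0 := by
    intro y
    rw [LinearMap.mem_ker, funext_iff]
    exact Subtype.forall
  suffices (LinearMap.ker Z).map C.H.mulVecLin = ⊤ by
    obtain ⟨y, hy, hym⟩ := (this ▸ Submodule.mem_top : m ∈ (LinearMap.ker Z).map C.H.mulVecLin)
    exact ⟨y, hym, (hZ y).1 hy⟩
  by_contra hne
  -- A functional `a` killing the image makes `vecMul a C.H` vanish on `ker Z`, so it is a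
  -- combination of observed vectors. Being in the row space too, it is 0, and surjectivity of `H`
  -- gives `a = 0`.
  obtain ⟨f, hf0, hf⟩ := Submodule.exists_le_ker_of_lt_top _ (lt_top_iff_ne_top.2 hne)
  obtain ⟨a, rfl⟩ := (dotProductEquiv F (Fin k)).surjective f
  have hvec : ∀ y, (Matrix.vecMul a C.H) ⬝ᵥ y = a ⬝ᵥ C.H.mulVec y := fun y =>
    (Matrix.dotProduct_mulVec a C.H y).symm
  have hker : ∀ y ∈ LinearMap.ker Z, (Matrix.vecMul a C.H) ⬝ᵥ y = 0 := by
    intro y hy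
    rw [hvec]
    exact hf (Submodule.mem_map_of_mem hy)
  have hmem : (Matrix.vecMul a C.H) ∈ Submodule.span F (w '' (W : Set E)) := by
    have := mem_span_of_iInf_ker_le_ker (L := fun e : W => dotProductEquiv F (Fin n) (w e))
      (K := dotProductEquiv F (Fin n) (Matrix.vecMul a C.H)) (by
        intro y hy
        simp only [Submodule.mem_iInf, LinearMap.mem_ker] at hy
        exact hker y ((hZ y).2 fun e he => hy ⟨e, he⟩))
    have h2 := Submodule.mem_map_of_mem (f := (dotProductEquiv F (Fin n)).symm.toLinearMap) this
    rw [Submodule.map_span, ← Set.range_comp] at h2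
    simp only [LinearEquiv.coe_coe, LinearEquiv.symm_apply_apply] at h2
    refine Submodule.span_mono ?_ h2
    rintro _ ⟨e, rfl⟩
    exact ⟨e, e.2, by simp⟩
  have hrow : (Matrix.vecMul a C.H) ∈ Submodule.span F (Set.range C.H.row) := by
    rw [Matrix.vecMul_eq_sum]
    exact Submodule.sum_mem _ fun i _ => Submodule.smul_mem _ _ (Submodule.subset_span ⟨i, rfl⟩)
  have hzero := Submodule.disjoint_def.1 h _ hrow hmem
  have hsurj : ∀ m : Fin k → F, ∃ y, C.H.mulVec y = m := by
    have h : LinearMap.range C.H.mulVecLin = ⊤ := by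
      apply Submodule.eq_top_of_finrank_eq
      have := C.rank_eq
      rw [Matrix.rank] at this
      simpa using this
    exact LinearMap.range_eq_top.1 h
  refine hf0 (LinearMap.ext fun m => ?_)
  obtain ⟨y, rfl⟩ := hsurj m
  change a ⬝ᵥ C.H.mulVec y = 0
  rw [← hvec, hzero, zero_dotProduct]

variable [Fintype F] [DecidableEq F]

/-- Translation by `y₀` maps one coset onto the other without changing the observed packets. -/
theorem map_encode_packets_eq (C : CosetCode F k n) (c : LinearNetworkCode G source F n)
    (W : Finset E) {m m' : Fin k → F} {y₀ : Fin n → F} (hy₀ : C.H.mulVec y₀ = m' - m)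
    (hW : ∀ e ∈ W, c.vec e ⬝ᵥ y₀ = 0) (z : W → F) :
    ((C.encode m).map (c.packets W)) z = ((C.encode m').map (c.packets W)) z := by
  classical
  have hmem : ∀ y, y ∈ C.coset m ↔ y + y₀ ∈ C.coset m' := by
    intro y
    simp only [CosetCode.coset, Finset.mem_filter, Finset.mem_univ, true_and, Matrix.mulVec_add,
      hy₀]
    rw [← eq_sub_iff_add_eq, sub_sub_cancel]
  have hcard : (C.coset m).card = (C.coset m').card :=
    Finset.card_bij' (fun y _ => y + y₀) (fun y _ => y - y₀) (fun y hy => (hmem y).1 hy)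
      (fun y hy => (hmem _).2 (by simpa using hy)) (by simp) (by simp)
  have hpack : ∀ y, c.packets W (y + y₀) = c.packets W y := by
    intro y
    funext e
    simp [LinearNetworkCode.packets, dotProduct_add, hW e e.2]
  rw [PMF.map_apply, PMF.map_apply, tsum_fintype, tsum_fintype]
  refine Fintype.sum_equiv (Equiv.addRight y₀) _ _ fun y => ?_
  simp only [Equiv.coe_addRight, hpack, CosetCode.encode, PMF.uniformOfFinset_apply, ← hmem, hcard]
  congr!

theorem condEntropy_wiretapLaw [DecidableEq E] (C : CosetCode F k n) (c : LinearNetworkCode G source F n)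
    (W : Finset E) (h : Disjoint (Submodule.span F (Set.range C.H.row))
      (Submodule.span F (c.vec '' (W : Set E)))) (p : PMF (Fin k → F)) :
    condEntropy (wiretapLaw C c p W) = entropy p := by
  classical
  refine condEntropy_eq_of_prod p ((C.encode 0).map (c.packets W)) _ fun m z => ?_
  have hz : ∀ m', ((C.encode m').map fun y => (m', c.packets W y)) (m, z) =
      if m' = m then ((C.encode 0).map (c.packets W)) z else 0 := by
    intro m'
    split_ifs with hm
    · subst hm
      obtain ⟨y₀, hy₀, hW⟩ := C.exists_mulVec_eq c.vec W h (m' - 0)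
      rw [map_encode_packets_eq C c W hy₀ hW z, PMF.map_apply, PMF.map_apply]
      simp only [Prod.mk.injEq, true_and]
      congr!
    · rw [PMF.map_apply]
      simp [Ne.symm hm]
  rw [wiretapLaw, PMF.bind_apply, tsum_fintype]
  simp [hz]

end Entropy

/-! ### Decoding and assembly -/

section Main

theorem LinearNetworkCode.decodable_of_linearIndependent {V E : Type*} [Fintype E] [DecidableEq V]
    {G : Network V E} {source : V} {F : Type*} [Field F] {n : ℕ}
    (c : LinearNetworkCode G source F n) {r : V} (e : Fin n → E) (he : ∀ j, G.head (e j) = r)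
    (h : LinearIndependent F fun j => c.vec (e j)) : c.Decodable r := by
  suffices Function.Injective (c.packets (G.inEdges r)) from
    ⟨Function.invFun (c.packets (G.inEdges r)), Function.leftInverse_invFun this⟩
  intro y y' hyy'
  let N : Matrix (Fin n) (Fin n) F := Matrix.of fun j => c.vec (e j)
  have hN : IsUnit N := Matrix.linearIndependent_rows_iff_isUnit.1 h
  refine (Matrix.mulVec_injective_iff_isUnit.2 hN) (funext fun j => ?_)
  exact congrFun hyy' ⟨e j, by simp [Network.inEdges, he j]⟩

/-- The code whose message is the first `k` of `n` symbols. -/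
theorem exists_cosetCode (F : Type*) [Field F] {k n : ℕ} (hkn : k ≤ n) :
    Nonempty (CosetCode F k n) := by
  refine ⟨⟨Matrix.of fun i => Pi.single (Fin.castLE hkn i) 1, ?_⟩⟩
  have := LinearIndependent.rank_matrix (M := Matrix.of fun i : Fin k =>
    (Pi.single (Fin.castLE hkn i) 1 : Fin n → F))
    ((Pi.linearIndependent_single_one (Fin n) F).comp _ (Fin.castLE_injective hkn))
  simpa using this

end Main

end WiretapNetwork

open WiretapNetwork

theorem corollary1 {V E : Type*} [Fintype V] [DecidableEq V] [Fintype E] [DecidableEq E]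
    (G : WiretapNetwork.Network V E) (hG : G.Acyclic)
    (source : V) (T : Finset V) (n k μ : ℕ)
    (hcut : ∀ r ∈ T, G.MinCutEq source r n)
    (hμ : 1 ≤ μ) (hk : k + μ ≤ n)
    (F : Type*) [Field F] [Fintype F] [DecidableEq F]
    (hq : (n ^ 3 * T.card ^ 2 + G.outDegree source).choose (μ - 1) + T.card < Fintype.card F) :
    ∃ (C : WiretapNetwork.CosetCode F k n) (c : WiretapNetwork.LinearNetworkCode G source F n),
      WiretapNetwork.IsSecureMulticast C c T μ := by
  obtain ⟨C⟩ := exists_cosetCode F (show k ≤ n by omega)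
  refine ⟨C, ?_⟩
  -- Without receivers the zero code works. Otherwise `n ≤ n ^ 3 * T.card ^ 2`, which yields the
  -- bound `μ - 1 ≤ M` needed below.
  rcases T.eq_empty_or_nonempty with rfl | hT
  · refine ⟨⟨0, 0, by simp⟩, by simp, fun p W _ => condEntropy_wiretapLaw C _ W ?_ p⟩
    refine Disjoint.mono_right (Submodule.span_le.2 ?_) disjoint_bot_right
    rintro _ ⟨e, -, rfl⟩
    rfl
  obtain ⟨ρ, hρ⟩ := hG.exists_rank
  let A₀ : Finset (E × E) := Finset.univ.filter fun p => G.head p.1 = G.tail p.2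
  have hA₀ : ∀ u v, (u, v) ∈ A₀ ↔ G.head u = G.tail v := fun u v => by simp [A₀]
  obtain ⟨A, P, hA, hP, hcard⟩ := exists_arcs_card_encoding_le (n := n) A₀
    (fun u v h => hρ u v ((hA₀ u v).1 h)) {e | G.tail e = source} T (fun r => {e | G.head e = r})
    (fun r hr => by
      obtain ⟨π, hπ⟩ := (hcut r hr).exists_flow
      refine ⟨π, ?_⟩
      convert hπ using 2
      ext p; simp [A₀])
  let In : E → Finset E := fun v => Finset.univ.filter fun u => (u, v) ∈ A
  have hIn : ∀ u v, u ∈ In v ↔ (u, v) ∈ A := fun u v => by simp [In]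
  let S : Finset E := Finset.univ.filter fun e => G.tail e = source
  have hS : ∀ v, v ∈ S ↔ G.tail v = source := fun v => by simp [S]
  have hM : n ^ 3 * 1 ^ 2 ≤ n ^ 3 * T.card ^ 2 := Nat.mul_le_mul_left _
    (Nat.pow_le_pow_left hT.card_pos 2)
  have hn : n ≤ n ^ 3 := Nat.le_self_pow (by norm_num) n
  obtain ⟨vec, hvec⟩ := exists_partialCode_univ (K := F) (μ := μ)
    (M := n ^ 3 * T.card ^ 2 + G.outDegree source) In (ρ := ρ)
    (fun v u hu => hρ u v ((hA₀ u v).1 (hA ((hIn u v).1 hu)))) S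
    ((Finset.univ.filter fun v => ∃ u w, u ≠ w ∧ (u, v) ∈ A ∧ (w, v) ∈ A) ∪ S) T P
    (fun r hr w => by
      have := hP r hr (.inl w)
      rcases hy : P r (.inl w) with u | j <;> rw [hy] at this
      · rcases this with rfl | h
        · exact .inl rfl
        · exact .inr (.inl ⟨u, (hIn u w).2 h, rfl⟩)
      · exact .inr (.inr ⟨(hS w).2 this, j, rfl⟩))
    (fun v hv => by
      rw [Finset.mem_union, not_or] at hv
      refine ⟨hv.2, Finset.card_le_one.2 fun u hu w hw => ?_⟩
      by_contra huw
      exact hv.1 (Finset.mem_filter.2 ⟨Finset.mem_univ v, u, w, huw, (hIn u v).1 hu,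
        (hIn w v).1 hw⟩))
    (Submodule.span F (Set.range C.H.row)) hμ
    (by rw [← Matrix.rank_eq_finrank_span_row, C.rank_eq]; exact hk)
    ((Finset.card_union_le _ _).trans (Nat.add_le_add_right hcard _)) (by omega) hq
  have hcoeff : ∀ e, ∃ a : E → F, G.tail e ≠ source →
      vec e = ∑ d ∈ G.inEdges (G.tail e), a d • vec d := by
    intro e
    by_cases he : G.tail e = source
    · exact ⟨0, fun h => absurd he h⟩
    have hsub : (In e : Set E) ⊆ G.inEdges (G.tail e) := fun d hd => by
      have := (hA₀ d e).1 (hA ((hIn d e).1 hd))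
      simpa [Network.inEdges] using this
    have hmem := Submodule.span_mono (Set.image_mono hsub)
      (hvec.mem_span e (Finset.mem_univ e) (fun h => he ((hS e).1 h)))
    obtain ⟨a, ha⟩ := (Submodule.mem_span_image_finset_iff_exists_fun' F).1 hmem
    exact ⟨a, fun _ => ha.symm⟩
  choose a ha using hcoeff
  obtain ⟨c, rfl⟩ : ∃ c : LinearNetworkCode G source F n, c.vec = vec :=
    ⟨⟨fun d e => a e d, vec, ha⟩, rfl⟩
  refine ⟨c, fun r hr => ?_, fun p W hW =>
    condEntropy_wiretapLaw C c W (hvec.secure W (Finset.subset_univ W) hW) p⟩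
  have hend : ∀ j, ∃ e, P r (.inr j) = .inl e ∧ G.head e = r := by
    intro j
    have := hP r hr (.inr j)
    rcases hy : P r (.inr j) with e | i <;> rw [hy] at this
    · exact ⟨e, rfl, this⟩
    · exact this.elim
  choose e he her using hend
  refine LinearNetworkCode.decodable_of_linearIndependent c e her ?_
  -- Once all edges are processed, the last edges of the `n` paths lie in the frontier.
  have hrange : LinearIndepOn F (withTokens c.vec) (Set.range (P r ∘ Sum.inr)) := by
    refine (hvec.linearIndepOn r hr).mono ?_
    rintro _ ⟨j, rfl⟩
    exact ⟨fun _ _ => Finset.mem_univ _, fun d _ h => by simpa using (P r).injective h⟩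
  rw [linearIndepOn_range_iff ((P r).injective.comp Sum.inr_injective)] at hrange
  convert hrange using 2 with j
  simp [he, withTokens]
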